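/- Let $X$ be a measurable space of records and let $D$ (data distribution) and $G$ (generator) be probability measures on $X$. Let $c,\gamma,\varepsilon\ge 0$ and let $m\in\mathbb N$. Assume that $G$ is $(c,\gamma)$-close to $D$, i.e. $e^{-c}\,(D(E)-\gamma)\le G(E)$ for every measurable $E\subseteq X$. Game. Draw independently $S\sim\mathrm{Bernoulli}(1/2)^m$, members $x^{\rm in}\sim D^{m}$ and generated points $x^{\rm gen}\sim G^{m}$, and put $X_i=x^{\rm in}_i$ if $S_i=1$ and $X_i=x^{\rm gen}_i$ if $S_i=0$. The target model is $f\sim M(x^{\rm in}_1,\dots,x^{\rm in}_m,r_1,\dots,r_k)$, where $r_1,\dots,r_k\in X$ are fixed further training records and $M$ is a randomized mechanism that is $\varepsilon$-DP: $\Pr[M(d)\in O]\le e^{\varepsilon}\Pr[M(d')\in O]$ for every measurable set $O$ of models and all datasets $d,d'$ of $m+k$ records that differ in the value of one record. The baseline scores $T^b=B(X)\in[0,1]^m$ are drawn by a Markov kernel from the audit set $X=(X_1,\dots,X_m)$ alone (for example $T^b_i=b(X_i)$ with a randomized score $b$), and the membership inference attack (MIA) scores $T^a=A(X,f)\in[0,1]^m$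 are drawn by a Markov kernel from $X$ and $f$. Then there are Markov kernels $F^b,F^a$ from $[0,1]^m$ to $\{0,1,\dots,m\}$ such that, for almost every value $t^b$ of $T^b$ and almost every value $t^a$ of $T^a$ (in particular for every value that is taken with positive probability), and all $v\in\mathbb R$, $$\Pr\Big[\sum_{i=1}^m T^b_iS_i\ge v\,\Big|\,T^b=t^b\Big]\le \Pr\Big[F^b(t^b)+\sum_{i=1}^m t^b_iS'_i\ge v\Big],\qquad S'\sim\mathrm{Bernoulli}\Big(\frac{e^{c}}{1+e^{c}}\Big)^m,$$ $$\Pr\Big[\sum_{i=1}^m T^a_iS_i\ge v\,\Big|\,T^a=t^a\Big]\le \Pr\Big[F^a(t^a)+\sum_{i=1}^m t^a_iS'_i\ge v\Big],\qquad S'\sim\mathrm{Bernoulli}\Big(\frac{e^{c+\varepsilon}}{1+e^{c+\varepsilon}}\Big)^m,$$ where on each right-hand side the variable $F^b(t^b)$ (resp. $F^a(t^a)$), which has the law given by the kernel, is independent of $S'$, and $$\mathbb E\big[F^b(T^b)\big]=\mathbb E\big[F^a(T^a)\big]\le 2m\gamma .$$ -/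

import Mathlib

open MeasureTheory ProbabilityTheory
open scoped ENNReal unitInterval

namespace MembershipAudit

noncomputable section

/-- `(c, γ)`-closeness of the generator `G` to the data distribution `D`:
`e^{-c} (D(S) - γ) ≤ G(S)` for every event `S`. It is one-sided. -/
def IsClose {X : Type*} [MeasurableSpace X] (c γ : ℝ) (G D : Measure X) : Prop :=
  ∀ S : Set X, MeasurableSet S → Real.exp (-c) * (D.real S - γ) ≤ G.real S

/-- Pure `ε`-differential privacy of a randomized mechanism `M` whose datasets are families of
records indexed by `ι`; neighbouring datasets differ in the value of one record. -/
def IsPureDP {ι X Θ : Type*} [MeasurableSpace X] [MeasurableSpace Θ] (ε : ℝ)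
    (M : Kernel (ι → X) Θ) : Prop :=
  ∀ d d' : ι → X, (∃ i, ∀ j, j ≠ i → d j = d' j) →
    ∀ O : Set Θ, MeasurableSet O → M d O ≤ ENNReal.ofReal (Real.exp ε) * M d' O

/-- The number `e^a / (1 + e^a)`. -/
def logistic (a : ℝ) : I :=
  ⟨Real.exp a / (1 + Real.exp a), by
    have h := Real.exp_pos a
    exact ⟨by positivity, by rw [div_le_one (by positivity)]; linarith⟩⟩

/-- The law `Bernoulli(p)^m`, with `true` standing for `1` and `false` for `0`. -/
def bernoulliVec (m : ℕ) (p : I) : Measure (Fin m → Bool) :=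
  Measure.pi fun _ => bernoulliMeasure true false p

/-- The weighted sum `∑ i, t i * s i`. -/
def score {m : ℕ} (t : Fin m → I) (s : Fin m → Bool) : ℝ :=
  ∑ i, (t i : ℝ) * (if s i then 1 else 0)

/-- Outcomes `(s, xin, xgen)` of the sampling step of the game: the coins, the members and the
generated points. -/
abbrev Draw (m : ℕ) (X : Type*) : Type _ :=
  (Fin m → Bool) × (Fin m → X) × (Fin m → X)

/-- The law of `(s, xin, xgen)`: independent, with `s` a vector of fair coins, the members
i.i.d. from `D` and the generated points i.i.d. from `G`. -/
def drawLaw {X : Type*} [MeasurableSpace X] (m : ℕ) (D G : Measure X) : Measure (Draw m X) :=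
  (bernoulliVec m ⟨1 / 2, by norm_num, by norm_num⟩).prod
    ((Measure.pi fun _ => D).prod (Measure.pi fun _ => G))

/-- The audit set: `x i` is the member `xin i` if `s i = 1`, the generated point `xgen i` if
`s i = 0`. -/
def auditSet {m : ℕ} {X : Type*} (w : Draw m X) : Fin m → X :=
  fun i => if w.1 i then w.2.1 i else w.2.2 i

/-- The training set of the target model: all the members `xin`, whatever the coins say,
and further fixed records `r`. -/
def trainingSet {m k : ℕ} {X : Type*} (r : Fin k → X) (w : Draw m X) : Fin m ⊕ Fin k → X :=
  Sum.elim w.2.1 r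

theorem measurable_auditSet {m : ℕ} {X : Type*} [MeasurableSpace X] :
    Measurable (auditSet : Draw m X → Fin m → X) := by
  refine measurable_pi_lambda _ fun i => ?_
  have hs : Measurable fun w : Draw m X => w.1 i := by fun_prop
  exact Measurable.ite (hs (measurableSet_singleton true)) (by fun_prop) (by fun_prop)

theorem measurable_trainingSet {m k : ℕ} {X : Type*} [MeasurableSpace X] (r : Fin k → X) :
    Measurable (trainingSet r : Draw m X → Fin m ⊕ Fin k → X) := by
  refine measurable_pi_lambda _ fun i => ?_
  rcases i with i | i
  · simp only [trainingSet, Sum.elim_inl]; fun_prop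
  · simp only [trainingSet, Sum.elim_inr]; fun_prop

/-- The joint law of `((s, xin, xgen), T)`, where the baseline `B` draws the scores `T` from the
audit set alone. -/
def baselineLaw {X : Type*} [MeasurableSpace X] {m : ℕ} (D G : Measure X)
    (B : Kernel (Fin m → X) (Fin m → I)) : Measure (Draw m X × (Fin m → I)) :=
  drawLaw m D G ⊗ₘ B.comap auditSet measurable_auditSet

/-- The joint law of `((s, xin, xgen), f)`, where the target model `f` is the output of the
mechanism `M` on the training set. -/
def modelLaw {X Θ : Type*} [MeasurableSpace X] [MeasurableSpace Θ] {m k : ℕ} (D G : Measure X)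
    (M : Kernel (Fin m ⊕ Fin k → X) Θ) (r : Fin k → X) : Measure (Draw m X × Θ) :=
  drawLaw m D G ⊗ₘ M.comap (trainingSet r) (measurable_trainingSet r)

/-- The joint law of `(((s, xin, xgen), f), T)`, where the membership inference attack `A` draws
the scores `T` from the audit set and the target model. -/
def attackLaw {X Θ : Type*} [MeasurableSpace X] [MeasurableSpace Θ] {m k : ℕ} (D G : Measure X)
    (M : Kernel (Fin m ⊕ Fin k → X) Θ) (r : Fin k → X)
    (A : Kernel ((Fin m → X) × Θ) (Fin m → I)) : Measure ((Draw m X × Θ) × (Fin m → I)) :=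
  modelLaw D G M r ⊗ₘ A.comap (fun z => (auditSet z.1, z.2))
    ((measurable_auditSet.comp measurable_fst).prodMk measurable_snd)

instance {m : ℕ} {p : I} : IsProbabilityMeasure (bernoulliVec m p) := by
  unfold bernoulliVec; infer_instance

instance {X : Type*} [MeasurableSpace X] {m : ℕ} {D G : Measure X} [IsProbabilityMeasure D]
    [IsProbabilityMeasure G] : IsProbabilityMeasure (drawLaw m D G) := by
  unfold drawLaw; infer_instance

instance {X : Type*} [MeasurableSpace X] {m : ℕ} {D G : Measure X} [IsProbabilityMeasure D]
    [IsProbabilityMeasure G] {B : Kernel (Fin m → X) (Fin m → I)} [IsMarkovKernel B] :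
    IsProbabilityMeasure (baselineLaw D G B) := by
  unfold baselineLaw; infer_instance

instance {X Θ : Type*} [MeasurableSpace X] [MeasurableSpace Θ] {m k : ℕ} {D G : Measure X}
    [IsProbabilityMeasure D] [IsProbabilityMeasure G] {M : Kernel (Fin m ⊕ Fin k → X) Θ}
    [IsMarkovKernel M] {r : Fin k → X} : IsProbabilityMeasure (modelLaw D G M r) := by
  unfold modelLaw; infer_instance

instance {X Θ : Type*} [MeasurableSpace X] [MeasurableSpace Θ] {m k : ℕ} {D G : Measure X}
    [IsProbabilityMeasure D] [IsProbabilityMeasure G] {M : Kernel (Fin m ⊕ Fin k → X) Θ}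
    [IsMarkovKernel M] {r : Fin k → X} {A : Kernel ((Fin m → X) × Θ) (Fin m → I)}
    [IsMarkovKernel A] : IsProbabilityMeasure (attackLaw D G M r A) := by
  unfold attackLaw; infer_instance

/-- The probability that `F + ∑ i, t i * S' i ≥ v` for independent `F ∼ ν` on `{0, …, m}` and
`S' ∼ Bernoulli(p)^m`. -/
def tailBound {m : ℕ} (p : I) (ν : Measure (Fin (m + 1))) (t : Fin m → I) (v : ℝ) : ℝ≥0∞ :=
  (ν.prod (bernoulliVec m p)) {q | v ≤ ((q.1 : ℕ) : ℝ) + score t q.2}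

/-- The mean `E[F(T)]` when `T ∼ μ` and, given `T = t`, `F(T) ∼ F t`. -/
def meanFailures {m : ℕ} (μ : Measure (Fin m → I)) (F : Kernel (Fin m → I) (Fin (m + 1))) :
    ℝ≥0∞ :=
  ∫⁻ t, ∫⁻ j, ((j : ℕ) : ℝ≥0∞) ∂(F t) ∂μ

end

end MembershipAudit

namespace MembershipAudit

/-! Closeness splits `D = D₁ + D₂` with `D₁ ≤ e^c G` and `D₂` of mass at most `γ`
(`IsClose.exists_add_eq`). Each member is drawn together with a flag telling which part it comes
from, and index `i` counts as a failure when its coin is `1` and its member is flagged. The flags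
are invisible to the mechanism and to the scores, so the game itself is unchanged.

Suppose index `i` has coin `1` and an unflagged member `x`. Swap this outcome for coin `0`,
generated point `x` and an arbitrary member `x'`. The audit set stays the same and the training set
changes in one record, so the law of the scores changes by a factor at most `e^ε`; drawing `x` from
`D₁` rather than `G` costs at most `e^c`. Hence, with the statuses at the other indices fixed and
the scores in any event, the odds of an unflagged `1` against a `0` are at most `e^(c+ε)`
(`status_odds_le`). For the baseline no model is involved and `ε = 0`.

An induction on `m` turns these odds into stochastic domination (`sum_tail_le_of_odds_le`): an
unflagged coin is dominated by a Bernoulli variable with these odds, and a flagged one is paid for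
by a unit of the flag count, since weights are at most `1`. The kernel `F` is the conditional law of
the number of failures given the scores (`exists_failure_kernel`). Its mean is `m D₂(X) / 2` for
both attacks, whatever the scores are. -/

/-! ### Tails of weighted Bernoulli sums -/

theorem bernoulliMeasure_real_true (p : I) :
    (bernoulliMeasure true false p).real {true} = p := by
  classical
  rw [bernoulliMeasure_real_apply p (measurableSet_singleton _)]
  simp

theorem bernoulliMeasure_real_false (p : I) :
    (bernoulliMeasure true false p).real {false} = 1 - p := by
  classical
  rw [bernoulliMeasure_real_apply p (measurableSet_singleton _)]
  simp

/-- The probability that `∑ i, t i * S' i ≥ x` for `S' ∼ Bernoulli(p)^m`. -/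
noncomputable def scoreTail {m : ℕ} (p : I) (t : Fin m → I) (x : ℝ) : ℝ :=
  (bernoulliVec m p).real {s | x ≤ score t s}

theorem scoreTail_nonneg {m : ℕ} (p : I) (t : Fin m → I) (x : ℝ) : 0 ≤ scoreTail p t x :=
  measureReal_nonneg

theorem scoreTail_antitone {m : ℕ} (p : I) (t : Fin m → I) : Antitone (scoreTail p t) :=
  fun _ _ h => measureReal_mono fun _ hs => h.trans hs

theorem bernoulliVec_real_singleton {m : ℕ} (p : I) (s : Fin m → Bool) :
    (bernoulliVec m p).real {s} = ∏ i, (bernoulliMeasure true false p).real {s i} := by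
  rw [measureReal_def, bernoulliVec, Measure.pi_singleton, ENNReal.toReal_prod]
  rfl

theorem scoreTail_eq_sum {m : ℕ} (p : I) (t : Fin m → I) (x : ℝ) :
    scoreTail p t x = ∑ s : Fin m → Bool, (if x ≤ score t s then 1 else 0) *
      ∏ i, (bernoulliMeasure true false p).real {s i} := by
  classical
  have h : {s : Fin m → Bool | x ≤ score t s}
      = ((Finset.univ.filter fun s : Fin m → Bool => x ≤ score t s : Finset _) : Set _) := by
    ext; simp
  rw [scoreTail, h, ← sum_measureReal_singleton, Finset.sum_filter]
  refine Finset.sum_congr rfl fun s _ => ?_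
  rw [bernoulliVec_real_singleton, ite_mul, one_mul, zero_mul]

theorem score_cons {m : ℕ} (t : Fin (m + 1) → I) (b : Bool) (s : Fin m → Bool) :
    score t (Fin.cons b s) = (t 0 : ℝ) * (if b then 1 else 0) + score (Fin.tail t) s := by
  simp [score, Fin.sum_univ_succ, Fin.tail]

theorem sum_fin_cons {α : Type*} [Fintype α] {m : ℕ} (f : (Fin (m + 1) → α) → ℝ) :
    ∑ w, f w = ∑ w : Fin m → α, ∑ a, f (Fin.cons a w) := by
  rw [← (Fin.consEquiv fun _ => α).sum_comp, Fintype.sum_prod_type, Finset.sum_comm]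
  rfl

theorem scoreTail_succ {m : ℕ} (p : I) (t : Fin (m + 1) → I) (x : ℝ) :
    scoreTail p t x = (1 - p) * scoreTail p (Fin.tail t) x
      + p * scoreTail p (Fin.tail t) (x - t 0) := by
  simp only [scoreTail_eq_sum]
  rw [sum_fin_cons, Finset.mul_sum, Finset.mul_sum, ← Finset.sum_add_distrib]
  refine Finset.sum_congr rfl fun s _ => ?_
  simp only [Fintype.sum_bool, score_cons, Fin.prod_univ_succ, Fin.cons_zero, Fin.cons_succ,
    bernoulliMeasure_real_true, bernoulliMeasure_real_false, sub_le_iff_le_add', if_true,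
    Bool.false_eq_true, if_false, mul_one, mul_zero, zero_add]
  ring

/-! ### Stochastic domination from bounded odds -/

/-- The number of indices whose second flag is set. -/
def flagCount {m : ℕ} (w : Fin m → Bool × Bool) : ℕ := ∑ i, if (w i).2 then 1 else 0

theorem flagCount_cons {m : ℕ} (a : Bool × Bool) (w : Fin m → Bool × Bool) :
    flagCount (Fin.cons a w : Fin (m + 1) → Bool × Bool)
      = (if a.2 then 1 else 0) + flagCount w := by
  rw [flagCount, Fin.sum_univ_succ]
  simp only [Fin.cons_zero, Fin.cons_succ, flagCount]

theorem flagCount_le {m : ℕ} (w : Fin m → Bool × Bool) : flagCount w ≤ m := by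
  refine (Finset.sum_le_card_nsmul _ _ 1 fun i _ => ?_).trans (by simp)
  split_ifs <;> simp

/-- If the odds of an unflagged `1` against an unflagged `0` are at most `e^a` at every index, the
rest being fixed, then `∑ i, t i * S i` is stochastically dominated by the number of flags plus
an independent `∑ i, t i * S' i` with `S' ∼ Bernoulli(e^a / (1 + e^a))^m`. -/
theorem sum_tail_le_of_odds_le (a : ℝ) : ∀ {m : ℕ} (t : Fin m → I)
    (k : (Fin m → Bool × Bool) → ℝ), (∀ w, 0 ≤ k w) →
    (∀ i w, k (Function.update w i (true, false))
      ≤ Real.exp a * k (Function.update w i (false, false))) → ∀ v : ℝ,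
    ∑ w, k w * (if v ≤ score t (fun i => (w i).1) then 1 else 0)
      ≤ ∑ w, k w * scoreTail (logistic a) t (v - flagCount w)
  | 0, t, k, _, _, v => by
    refine le_of_eq (Finset.sum_congr rfl fun w _ => ?_)
    rw [scoreTail_eq_sum]
    simp [score, flagCount]
  | m + 1, t, k, hk, hodds, v => by
    -- The odds hypothesis passes to each slice with the head status fixed, because it is assumed
    -- for every value of the other coordinates.
    have ih : ∀ b : Bool × Bool, ∑ w, k (Fin.cons b w) *
          (if v ≤ score t (fun i => ((Fin.cons b w : Fin (m + 1) → Bool × Bool) i).1) then 1 else 0)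
        ≤ ∑ w, k (Fin.cons b w) * scoreTail (logistic a) (Fin.tail t)
            (v - (t 0 : ℝ) * (if b.1 then 1 else 0) - flagCount w) := by
      intro b
      have := sum_tail_le_of_odds_le a (Fin.tail t) (fun w => k (Fin.cons b w))
        (fun w => hk _) (fun i w => by simpa [Fin.cons_update] using hodds i.succ (Fin.cons b w))
        (v - (t 0 : ℝ) * (if b.1 then 1 else 0))
      refine le_trans (le_of_eq (Finset.sum_congr rfl fun w _ => ?_)) this
      have h : (fun i => ((Fin.cons b w : Fin (m + 1) → Bool × Bool) i).1)
          = Fin.cons b.1 fun i => (w i).1 := by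
        ext i; refine Fin.cases ?_ (fun j => ?_) i <;> simp
      simp only [h, score_cons, sub_le_iff_le_add']
    rw [sum_fin_cons, Finset.sum_comm, sum_fin_cons]
    refine (Finset.sum_le_sum fun b _ => ih b).trans ?_
    rw [Finset.sum_comm]
    refine Finset.sum_le_sum fun w _ => ?_
    have hodd := hodds 0 (Fin.cons (true, false) w)
    simp only [Fin.update_cons_zero] at hodd
    have h0 := (t 0).2.1
    have h1 := (t 0).2.2
    have hTT := hk (Fin.cons (true, true) w)
    have hFT := hk (Fin.cons (false, true) w)
    have anti := scoreTail_antitone (logistic a) (Fin.tail t)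
    have hp : ((logistic a : I) : ℝ) = Real.exp a / (1 + Real.exp a) := rfl
    have hp0 := (logistic a).2.1
    have hp1 := (logistic a).2.2
    simp only [Fintype.sum_prod_type, Fintype.sum_bool, scoreTail_succ, flagCount_cons, if_true,
      Bool.false_eq_true, if_false, mul_one, mul_zero, sub_zero, zero_add, Nat.cast_add, Nat.cast_zero,
      Nat.cast_one]
    set q := scoreTail (logistic a) (Fin.tail t)
    set p : ℝ := ((logistic a : I) : ℝ)
    -- `p / (1 - p) = e^a`, so this is the odds hypothesis at the head index.
    have key : k (Fin.cons (true, false) w) * (1 - p) ≤ k (Fin.cons (false, false) w) * p := by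
      have he : 0 < 1 + Real.exp a := by positivity
      have : 1 - p = 1 / (1 + Real.exp a) := by rw [hp]; field_simp; ring
      rw [this, hp, mul_one_div, mul_div_assoc', mul_comm (k (Fin.cons (false, false) w))]
      gcongr
    -- Flagged head: as `0 ≤ t 0 ≤ 1`, the extra unit in the count lowers the threshold at least as
    -- much as the head coin can, whatever the independent coin `S'` shows.
    have e1 : q (v - t 0 - flagCount w) ≤ (1 - p) * q (v - (1 + flagCount w))
        + p * q (v - (1 + flagCount w) - t 0) := by
      have i1 := anti (show v - (1 + (flagCount w : ℝ)) ≤ v - t 0 - flagCount w by linarith)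
      have i2 := anti (show v - (1 + (flagCount w : ℝ)) - t 0 ≤ v - t 0 - flagCount w by linarith)
      nlinarith
    have e2 : q (v - flagCount w) ≤ (1 - p) * q (v - (1 + flagCount w))
        + p * q (v - (1 + flagCount w) - t 0) := by
      have i1 := anti (show v - (1 + (flagCount w : ℝ)) ≤ v - flagCount w by linarith)
      have i2 := anti (show v - (1 + (flagCount w : ℝ)) - t 0 ≤ v - flagCount w by linarith)
      nlinarith
    have e3 := anti (show v - t 0 - (flagCount w : ℝ) ≤ v - flagCount w by linarith)
    have c1 := mul_le_mul_of_nonneg_left e1 hTT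
    have c2 := mul_le_mul_of_nonneg_left e2 hFT
    -- Unflagged head: right side minus left side is `(k(0) p - k(1) (1 - p)) * (q (v - t 0 - n) - q
    -- (v - n))`, with `n` the flag count of the tail; both factors are nonnegative.
    have c3 := mul_le_mul_of_nonneg_right key (sub_nonneg.2 e3)
    rw [show v - (flagCount w : ℝ) - t 0 = v - t 0 - flagCount w by ring]
    linarith

/-! ### Failure kernels by disintegration -/

/-- `flagCount` with values in `{0, …, m}`. -/
def flagCountFin {m : ℕ} (w : Fin m → Bool × Bool) : Fin (m + 1) :=
  ⟨flagCount w, Nat.lt_succ_of_le (flagCount_le w)⟩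

@[fun_prop]
theorem measurable_score {m : ℕ} {Ω : Type*} [MeasurableSpace Ω] {t : Ω → Fin m → I}
    {s : Ω → Fin m → Bool} (ht : Measurable t) (hs : Measurable s) :
    Measurable fun ω => score (t ω) (s ω) := by
  unfold score
  have h : Measurable fun b : Bool => if b then (1 : ℝ) else 0 := measurable_of_finite _
  refine Finset.measurable_sum _ fun i _ => ?_
  refine Measurable.mul ?_ (h.comp ((measurable_pi_apply i).comp hs))
  exact measurable_subtype_coe.comp ((measurable_pi_apply i).comp ht)

theorem tailBound_map_flagCountFin {m : ℕ} (p : I) (κ : Measure (Fin m → Bool × Bool))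
    [IsProbabilityMeasure κ] (t : Fin m → I) (v : ℝ) :
    tailBound p (κ.map flagCountFin) t v
      = ENNReal.ofReal (∑ w, κ.real {w} * scoreTail p t (v - flagCount w)) := by
  have : IsProbabilityMeasure (κ.map (flagCountFin (m := m))) :=
    Measure.isProbabilityMeasure_map (measurable_of_finite _).aemeasurable
  rw [tailBound, Measure.prod_apply (Set.toFinite _).measurableSet,
    lintegral_map (measurable_of_finite _) (measurable_of_finite _), lintegral_fintype,
    ENNReal.ofReal_sum_of_nonneg fun w _ => mul_nonneg measureReal_nonneg (scoreTail_nonneg _ _ _)]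
  refine Finset.sum_congr rfl fun w _ => ?_
  rw [ENNReal.ofReal_mul measureReal_nonneg, ofReal_measureReal, scoreTail, ofReal_measureReal,
    mul_comm]
  congr 2
  ext s
  simp [flagCountFin, add_comm]

theorem measure_score_le_tailBound {m : ℕ} (a : ℝ) (κ : Measure (Fin m → Bool × Bool))
    [IsProbabilityMeasure κ] (h : ∀ (i : Fin m) (w : Fin m → Bool × Bool), κ {Function.update w i (true, false)}
      ≤ ENNReal.ofReal (Real.exp a) * κ {Function.update w i (false, false)})
    (t : Fin m → I) (v : ℝ) :
    κ {w | v ≤ score t fun i => (w i).1} ≤ tailBound (logistic a) (κ.map flagCountFin) t v := by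
  classical
  have hs : {w : Fin m → Bool × Bool | v ≤ score t fun i => (w i).1}
      = ((Finset.univ.filter fun w : Fin m → Bool × Bool => v ≤ score t fun i => (w i).1 :
        Finset _) : Set _) := by
    ext; simp
  rw [tailBound_map_flagCountFin, ← ofReal_measureReal, hs, ← sum_measureReal_singleton,
    Finset.sum_filter]
  refine ENNReal.ofReal_le_ofReal ?_
  refine le_trans (le_of_eq (Finset.sum_congr rfl fun w _ => ?_)) (sum_tail_le_of_odds_le a t
    (fun w => κ.real {w}) (fun _ => measureReal_nonneg) (fun i w => ?_) v)
  · rw [mul_ite, mul_one, mul_zero]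
  · have := ENNReal.toReal_mono (by finiteness) (h i w)
    rwa [ENNReal.toReal_mul, ENNReal.toReal_ofReal (Real.exp_pos a).le] at this

/-- The flags need not exist on `Ω`: `ρ` is a law of statuses and scores on a richer space, and only
its marginal on coins and scores has to match. Disintegrating `ρ` over the scores reduces the claim
to the domination lemma at almost every `t`. -/
theorem exists_failure_kernel {m : ℕ} (a : ℝ) {Ω : Type*} [MeasurableSpace Ω] (μ : Measure Ω)
    [IsProbabilityMeasure μ] {S : Ω → Fin m → Bool} {T : Ω → Fin m → I} (hS : Measurable S)
    (hT : Measurable T) (ρ : Measure ((Fin m → Bool × Bool) × (Fin m → I)))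
    [IsProbabilityMeasure ρ]
    (hρ : μ.map (fun ω => (S ω, T ω)) = ρ.map fun z => (fun i => (z.1 i).1, z.2))
    (hodds : ∀ (i : Fin m) (w : Fin m → Bool × Bool) E, MeasurableSet E → ρ ({Function.update w i (true, false)} ×ˢ E)
      ≤ ENNReal.ofReal (Real.exp a) * ρ ({Function.update w i (false, false)} ×ˢ E)) :
    ∃ F : Kernel (Fin m → I) (Fin (m + 1)), IsMarkovKernel F ∧
      (∀ᵐ t ∂(μ.map T), ∀ v : ℝ, condDistrib (fun ω => score (T ω) (S ω)) T μ t (Set.Ici v)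
        ≤ tailBound (logistic a) (F t) t v) ∧
      meanFailures (μ.map T) F = ∫⁻ z, (flagCount z.1 : ℝ≥0∞) ∂ρ := by
  set κ : Kernel (Fin m → I) (Fin m → Bool × Bool) := condDistrib Prod.fst Prod.snd ρ
  have hcount : Measurable (flagCountFin (m := m)) := measurable_of_finite _
  have hsel : Measurable fun z : (Fin m → Bool × Bool) × (Fin m → I) =>
      ((fun i => (z.1 i).1 : Fin m → Bool), z.2) := by fun_prop
  have hμT : μ.map T = ρ.map Prod.snd := by
    have := congrArg (Measure.map Prod.snd) hρ
    rwa [Measure.map_map measurable_snd (by fun_prop), Measure.map_map measurable_snd hsel] at this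
  have hκ : ρ.map Prod.snd ⊗ₘ κ = ρ.map fun z => (z.2, z.1) :=
    compProd_map_condDistrib measurable_fst.aemeasurable
  -- The conditional law depends only on the joint law of the scores and the weighted sum, hence may
  -- be computed under `ρ`.
  have hcond : condDistrib (fun ω => score (T ω) (S ω)) T μ
      = condDistrib (fun z => score z.2 fun i => (z.1 i).1) Prod.snd ρ := by
    have hg : Measurable fun z : (Fin m → Bool) × (Fin m → I) => (z.2, score z.2 z.1) := by
      fun_prop
    have := congrArg (Measure.map fun z => (z.2, score z.2 z.1)) hρ
    rw [Measure.map_map hg (by fun_prop), Measure.map_map hg hsel] at this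
    rw [condDistrib, condDistrib]
    congr 1
  have hφ : Measurable fun z : (Fin m → I) × (Fin m → Bool × Bool) =>
      score z.1 fun i => (z.2 i).1 := by fun_prop
  set κ' : Kernel (Fin m → I) ℝ := (Kernel.id ×ₖ κ).map fun z => score z.1 fun i => (z.2 i).1
  have hκ' : ∀ t {s : Set ℝ}, MeasurableSet s →
      κ' t s = κ t ((fun w => score t fun i => (w i).1) ⁻¹' s) := by
    intro t s hs
    rw [Kernel.map_apply' _ hφ _ hs, Kernel.prod_apply, Kernel.id_apply,
      Measure.dirac_prod, Measure.map_apply (by fun_prop) (hφ hs)]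
    rfl
  have hmk : IsMarkovKernel κ' := Kernel.IsMarkovKernel.map _ hφ
  have hjoint : ρ.map (fun z => (z.2, score z.2 fun i => (z.1 i).1)) = ρ.map Prod.snd ⊗ₘ κ' := by
    have hψ : Measurable fun z : (Fin m → I) × (Fin m → Bool × Bool) =>
        (z.1, score z.1 fun i => (z.2 i).1) := by fun_prop
    ext s hs
    have h1 : ρ.map (fun z => (z.2, score z.2 fun i => (z.1 i).1))
        = (ρ.map Prod.snd ⊗ₘ κ).map fun z => (z.1, score z.1 fun i => (z.2 i).1) := by
      rw [hκ, Measure.map_map hψ (by fun_prop)]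
      rfl
    rw [h1, Measure.map_apply hψ hs, Measure.compProd_apply (hψ hs), Measure.compProd_apply hs]
    refine lintegral_congr fun t => ?_
    rw [hκ' t (measurable_prodMk_left hs)]
    rfl
  refine ⟨κ.map flagCountFin, Kernel.IsMarkovKernel.map _ hcount, ?_, ?_⟩
  -- The bound on rectangles says that the set integrals are ordered, which orders the conditional
  -- probabilities almost everywhere. Only finitely many `i` and `w` occur, so one null set serves
  -- them all, and every `v` afterwards.
  · have hae : ∀ᵐ t ∂(ρ.map Prod.snd), ∀ (i : Fin m) (w : Fin m → Bool × Bool), κ t {Function.update w i (true, false)}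
        ≤ ENNReal.ofReal (Real.exp a) * κ t {Function.update w i (false, false)} := by
      rw [ae_all_iff]; intro i; rw [ae_all_iff]; intro w
      have hint : ∀ x (E : Set (Fin m → I)), MeasurableSet E →
          ∫⁻ t in E, κ t {x} ∂(ρ.map Prod.snd) = ρ ({x} ×ˢ E) := by
        intro x E hE
        rw [← Measure.compProd_apply_prod hE (measurableSet_singleton x), hκ,
          Measure.map_apply (by fun_prop) (hE.prod (measurableSet_singleton x))]
        congr 1
        ext; simp [and_comm]
      refine ae_le_of_forall_setLIntegral_le_of_sigmaFinite
        (Kernel.measurable_coe _ (measurableSet_singleton _)) fun E hE _ => ?_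
      rw [lintegral_const_mul _ (Kernel.measurable_coe _ (measurableSet_singleton _)),
        hint _ _ hE, hint _ _ hE]
      exact hodds i w E hE
    rw [hμT, hcond]
    filter_upwards [hae, condDistrib_ae_eq_of_measure_eq_compProd (X := Prod.snd) (μ := ρ)
      (by fun_prop : Measurable fun z : (Fin m → Bool × Bool) × (Fin m → I) =>
        score z.2 fun i => (z.1 i).1).aemeasurable hjoint] with t ht ht' v
    rw [ht', hκ' t measurableSet_Ici, Kernel.map_apply _ hcount]
    exact measure_score_le_tailBound a (κ t) ht t v
  · have hc : Measurable fun w : Fin m → Bool × Bool => (flagCount w : ℝ≥0∞) :=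
      measurable_of_finite _
    rw [meanFailures, hμT]
    have : ∀ t, ∫⁻ j, ((j : ℕ) : ℝ≥0∞) ∂(κ.map flagCountFin t) = ∫⁻ w, flagCount w ∂(κ t) := by
      intro t
      rw [Kernel.map_apply _ hcount, lintegral_map (measurable_of_finite _) hcount]
      rfl
    simp_rw [this]
    rw [← Measure.lintegral_compProd (f := fun z => (flagCount z.2 : ℝ≥0∞))
      (hc.comp measurable_snd), hκ]
    exact lintegral_map (hc.comp measurable_snd) (by fun_prop)

/-! ### Splitting the data distribution -/

/-- `(c, γ)`-closeness splits the data distribution into a part dominated by `e^c G` and a part of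
mass at most `γ`. -/
theorem IsClose.exists_add_eq {X : Type*} [MeasurableSpace X] {c γ : ℝ} {G D : Measure X}
    [IsFiniteMeasure D] [IsFiniteMeasure G] (h : IsClose c γ G D) :
    ∃ D₁ D₂ : Measure X, D = D₁ + D₂ ∧ D₁ ≤ ENNReal.ofReal (Real.exp c) • G ∧
      D₂ Set.univ ≤ ENNReal.ofReal γ := by
  set ν := ENNReal.ofReal (Real.exp c) • G
  have : IsFiniteMeasure ν := G.smul_finite ENNReal.ofReal_ne_top
  -- On `s` one has `D ≤ ν`, on `sᶜ` the reverse. The two parts are then the minimum of `D` and `ν`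
  -- and the excess of `D` over `ν`.
  obtain ⟨s, hs, hle, hge⟩ := exists_isHahnDecomposition D ν
  refine ⟨D.restrict s + ν.restrict sᶜ, D.restrict sᶜ - ν.restrict sᶜ, ?_, ?_, ?_⟩
  · rw [add_assoc, add_comm (ν.restrict sᶜ), Measure.sub_add_cancel_of_le hge,
      Measure.restrict_add_restrict_compl hs]
  · conv_rhs => rw [← Measure.restrict_add_restrict_compl (μ := ν) hs]
    exact add_le_add_left hle _
  · rw [Measure.sub_apply MeasurableSet.univ hge, Measure.restrict_apply_univ,
      Measure.restrict_apply_univ, tsub_le_iff_right]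
    -- The excess lives on `sᶜ`, so closeness is needed for this single event.
    have h1 := h sᶜ hs.compl
    rw [Real.exp_neg, inv_mul_le_iff₀ (Real.exp_pos c)] at h1
    have h2 : D.real sᶜ ≤ γ + Real.exp c * G.real sᶜ := by linarith
    have h3 : ν sᶜ = ENNReal.ofReal (Real.exp c * G.real sᶜ) := by
      rw [ENNReal.ofReal_mul (Real.exp_pos c).le, ofReal_measureReal]; rfl
    rw [h3, ← ofReal_measureReal (μ := D)]
    exact (ENNReal.ofReal_le_ofReal h2).trans ENNReal.ofReal_add_le

/-! ### The sampling step with flagged members -/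

section Extended

variable {X : Type*} [MeasurableSpace X]

/-- The law of a member together with a flag telling which part of the data distribution
`D₁ + D₂` it comes from. -/
noncomputable def flaggedLaw (D₁ D₂ : Measure X) : Measure (X × Bool) :=
  D₁.map (fun x => (x, false)) + D₂.map (fun x => (x, true))

/-- The law of a coin, a flagged member and a generated point, for one index. -/
noncomputable def recordLaw (D₁ D₂ G : Measure X) : Measure (Bool × (X × Bool) × X) :=
  (bernoulliMeasure true false ⟨1 / 2, by norm_num, by norm_num⟩).prod ((flaggedLaw D₁ D₂).prod G)

/-- The outcome of the sampling step, without the flags. -/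
def toDraw {m : ℕ} (z : Fin m → Bool × (X × Bool) × X) : Draw m X :=
  (fun i => (z i).1, fun i => (z i).2.1.1, fun i => (z i).2.2)

/-- The coins, each with the flag of the member if the coin shows `1`. -/
def status {m : ℕ} (z : Fin m → Bool × (X × Bool) × X) : Fin m → Bool × Bool :=
  fun i => ((z i).1, (z i).1 && (z i).2.1.2)

@[fun_prop]
theorem measurable_toDraw {m : ℕ} :
    Measurable (toDraw : (Fin m → Bool × (X × Bool) × X) → Draw m X) := by
  unfold toDraw; fun_prop

@[fun_prop]
theorem measurable_status {m : ℕ} :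
    Measurable (status : (Fin m → Bool × (X × Bool) × X) → Fin m → Bool × Bool) := by
  refine measurable_pi_lambda _ fun i => ?_
  have h : Measurable fun b : Bool × Bool => (b.1, b.1 && b.2) := measurable_of_finite _
  exact h.comp (g := fun b : Bool × Bool => (b.1, b.1 && b.2))
    (by fun_prop : Measurable fun z : Fin m → Bool × (X × Bool) × X => ((z i).1, (z i).2.1.2))

theorem lintegral_flaggedLaw (D₁ D₂ : Measure X) {f : X × Bool → ℝ≥0∞} (hf : Measurable f) :
    ∫⁻ y, f y ∂(flaggedLaw D₁ D₂) = ∫⁻ x, f (x, false) ∂D₁ + ∫⁻ x, f (x, true) ∂D₂ := by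
  rw [flaggedLaw, lintegral_add_measure, lintegral_map hf (by fun_prop),
    lintegral_map hf (by fun_prop)]

theorem map_fst_flaggedLaw (D₁ D₂ : Measure X) : (flaggedLaw D₁ D₂).map Prod.fst = D₁ + D₂ := by
  rw [flaggedLaw, Measure.map_add _ _ measurable_fst, Measure.map_map measurable_fst (by fun_prop),
    Measure.map_map measurable_fst (by fun_prop)]
  exact congrArg₂ _ Measure.map_id Measure.map_id

instance (D₁ D₂ : Measure X) [IsProbabilityMeasure (D₁ + D₂)] :
    IsProbabilityMeasure (flaggedLaw D₁ D₂) := by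
  constructor
  rw [← Set.preimage_univ (f := Prod.fst), ← Measure.map_apply measurable_fst MeasurableSet.univ,
    map_fst_flaggedLaw, measure_univ]

instance (D₁ D₂ G : Measure X) [IsProbabilityMeasure (D₁ + D₂)] [IsProbabilityMeasure G] :
    IsProbabilityMeasure (recordLaw D₁ D₂ G) := by
  unfold recordLaw; infer_instance

theorem lintegral_bernoulli_half (f : Bool → ℝ≥0∞) :
    ∫⁻ b, f b ∂(bernoulliMeasure true false ⟨1 / 2, by norm_num, by norm_num⟩)
      = 2⁻¹ * f true + 2⁻¹ * f false := by
  have h : ((unitInterval.toNNReal ⟨1 / 2, by norm_num, by norm_num⟩ : NNReal) : ℝ≥0∞) = 2⁻¹ := by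
    rw [← ENNReal.coe_ofNat, ← ENNReal.coe_inv (by norm_num)]
    congr 1
    ext
    simp
  have h' : ((unitInterval.toNNReal (unitInterval.symm ⟨1 / 2, by norm_num, by norm_num⟩) : NNReal) :
      ℝ≥0∞) = 2⁻¹ := by
    rw [← ENNReal.coe_ofNat, ← ENNReal.coe_inv (by norm_num)]
    congr 1
    ext
    simp [unitInterval.symm]
    norm_num
  rw [bernoulliMeasure_def, lintegral_add_measure, lintegral_smul_measure, lintegral_smul_measure,
    lintegral_dirac, lintegral_dirac, ENNReal.smul_def, ENNReal.smul_def, h, h', smul_eq_mul,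
    smul_eq_mul]

theorem lintegral_recordLaw (D₁ D₂ G : Measure X) [IsProbabilityMeasure (D₁ + D₂)]
    [IsProbabilityMeasure G] {f : Bool × (X × Bool) × X → ℝ≥0∞} (hf : Measurable f) :
    ∫⁻ y, f y ∂(recordLaw D₁ D₂ G)
      = 2⁻¹ * (∫⁻ x, ∫⁻ g, f (true, (x, false), g) ∂G ∂D₁ + ∫⁻ x, ∫⁻ g, f (true, (x, true), g) ∂G ∂D₂)
      + 2⁻¹ * (∫⁻ x, ∫⁻ g, f (false, (x, false), g) ∂G ∂D₁
        + ∫⁻ x, ∫⁻ g, f (false, (x, true), g) ∂G ∂D₂) := by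
  have hb : ∀ b : Bool, ∫⁻ y, f (b, y) ∂((flaggedLaw D₁ D₂).prod G)
      = ∫⁻ x, ∫⁻ g, f (b, (x, false), g) ∂G ∂D₁ + ∫⁻ x, ∫⁻ g, f (b, (x, true), g) ∂G ∂D₂ := by
    intro b
    have hfb : Measurable fun y => f (b, y) := hf.comp measurable_prodMk_left
    rw [lintegral_prod _ hfb.aemeasurable, lintegral_flaggedLaw _ _ hfb.lintegral_prod_right']
  rw [recordLaw, lintegral_prod _ hf.aemeasurable, lintegral_bernoulli_half, hb, hb]

/-- Forgetting the flags recovers the game. What remains is to regroup a product over indices of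
triples into a triple of products. -/
theorem map_toDraw {m : ℕ} (D₁ D₂ G : Measure X) [IsProbabilityMeasure (D₁ + D₂)]
    [IsProbabilityMeasure G] :
    (Measure.pi fun _ : Fin m => recordLaw D₁ D₂ G).map toDraw = drawLaw m (D₁ + D₂) G := by
  set β := bernoulliMeasure true false ⟨1 / 2, by norm_num, by norm_num⟩
  have h1 : (recordLaw D₁ D₂ G).map (Prod.map id (Prod.map Prod.fst id))
      = β.prod ((D₁ + D₂).prod G) := by
    rw [recordLaw, ← Measure.map_prod_map _ _ measurable_id (by fun_prop),
      ← Measure.map_prod_map _ _ measurable_fst measurable_id, map_fst_flaggedLaw, Measure.map_id,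
      Measure.map_id]
  have h2 : (Measure.pi fun _ : Fin m => recordLaw D₁ D₂ G).map
      (fun z i => Prod.map id (Prod.map Prod.fst id) (z i))
      = Measure.pi fun _ => β.prod ((D₁ + D₂).prod G) := by
    have : SigmaFinite ((recordLaw D₁ D₂ G).map (Prod.map id (Prod.map Prod.fst id))) := by
      rw [h1]; infer_instance
    rw [Measure.pi_map_pi fun _ => (by fun_prop), h1]
  have e1 := measurePreserving_arrowProdEquivProdArrow Bool (X × X) (Fin m) (fun _ => β)
    (fun _ => (D₁ + D₂).prod G)
  have e2 := measurePreserving_arrowProdEquivProdArrow X X (Fin m) (fun _ => D₁ + D₂) (fun _ => G)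
  have e3 := ((MeasurePreserving.id (Measure.pi fun _ : Fin m => β)).prod e2).comp e1
  rw [drawLaw, bernoulliVec, ← e3.map_eq, ← h2, Measure.map_map e3.measurable (by fun_prop)]
  rfl

/-- Tonelli, integrating coordinate `i` first: this allows records to be compared at one index with
all others frozen. -/
theorem lintegral_pi_le_of_update {ι Y : Type*} [Fintype ι] [DecidableEq ι] [MeasurableSpace Y]
    (ν : Measure Y) [SigmaFinite ν] {f g : (ι → Y) → ℝ≥0∞} (hf : Measurable f) (hg : Measurable g)
    (i : ι) (h : ∀ z, ∫⁻ y, f (Function.update z i y) ∂ν ≤ ∫⁻ y, g (Function.update z i y) ∂ν) :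
    ∫⁻ z, f z ∂(Measure.pi fun _ => ν) ≤ ∫⁻ z, g z ∂(Measure.pi fun _ => ν) := by
  rcases isEmpty_or_nonempty (ι → Y) with hE | ⟨⟨z⟩⟩
  · simp [lintegral_of_isEmpty]
  · rw [lintegral_eq_lmarginal_univ z, lintegral_eq_lmarginal_univ z,
      lmarginal_erase' _ hf (Finset.mem_univ i), lmarginal_erase' _ hg (Finset.mem_univ i)]
    exact lmarginal_mono h z

/-- Each index fails with probability `D₂(X) / 2`, since the coin is independent of the flag. The
scores play no role, which is why the baseline and the attack get the same mean. -/
theorem lintegral_flagCount_status {m : ℕ} (D₁ D₂ G : Measure X) [IsProbabilityMeasure (D₁ + D₂)]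
    [IsProbabilityMeasure G] :
    ∫⁻ z, (flagCount (status z) : ℝ≥0∞) ∂(Measure.pi fun _ : Fin m => recordLaw D₁ D₂ G)
      = m * (2⁻¹ * D₂ Set.univ) := by
  have hg : Measurable fun y : Bool × (X × Bool) × X =>
      if (y.1 && y.2.1.2) then (1 : ℝ≥0∞) else 0 := by
    have h : Measurable fun b : Bool × Bool => if (b.1 && b.2) then (1 : ℝ≥0∞) else 0 :=
      measurable_of_finite _
    exact h.comp (by fun_prop : Measurable fun y : Bool × (X × Bool) × X => (y.1, y.2.1.2))
  have h1 : ∀ z : Fin m → Bool × (X × Bool) × X, (flagCount (status z) : ℝ≥0∞)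
      = ∑ i, if ((z i).1 && (z i).2.1.2) then (1 : ℝ≥0∞) else 0 := by
    intro z
    rw [flagCount, Nat.cast_sum]
    exact Finset.sum_congr rfl fun i _ => by simp [status]
  simp_rw [h1]
  rw [lintegral_finsetSum (f := fun i (z : Fin m → Bool × (X × Bool) × X) =>
    if ((z i).1 && (z i).2.1.2) then (1 : ℝ≥0∞) else 0) _
    fun i _ => hg.comp (measurable_pi_apply i)]
  have h2 : ∀ i : Fin m, ∫⁻ z, (if ((z i).1 && (z i).2.1.2) then (1 : ℝ≥0∞) else 0)
      ∂(Measure.pi fun _ : Fin m => recordLaw D₁ D₂ G) = 2⁻¹ * D₂ Set.univ := by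
    intro i
    rw [(measurePreserving_eval (fun _ : Fin m => recordLaw D₁ D₂ G) i).lintegral_comp hg,
      lintegral_recordLaw _ _ _ hg]
    simp
  rw [Finset.sum_congr rfl fun i _ => h2 i, Finset.sum_const, Finset.card_univ, Fintype.card_fin,
    nsmul_eq_mul]

end Extended

/-! ### Odds of a status at one index -/

theorem status_update_eq_iff {X : Type*} {m : ℕ} (z : Fin m → Bool × (X × Bool) × X) (i : Fin m)
    (y : Bool × (X × Bool) × X) (w : Fin m → Bool × Bool) (a : Bool × Bool) :
    status (Function.update z i y) = Function.update w i a ↔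
      (y.1, y.1 && y.2.1.2) = a ∧ ∀ j, j ≠ i → status z j = w j := by
  have h : status (Function.update z i y) = Function.update (status z) i (y.1, y.1 && y.2.1.2) := by
    ext j <;> by_cases hj : j = i
    · subst hj; simp [status]
    · simp [status, hj]
    · subst hj; simp [status]
    · simp [status, hj]
  rw [h]
  constructor
  · intro h
    refine ⟨by simpa using congrFun h i, fun j hj => by simpa [hj] using congrFun h j⟩
  · rintro ⟨rfl, h⟩
    ext1 j
    by_cases hj : j = i
    · subst hj; simp
    · simp [hj, h j hj]

section Extended

variable {X : Type*} [MeasurableSpace X]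

/-- Given the coins, the flags and the scores at every other index, the odds of an unflagged `1`
against a `0` are at most `e^(c + ε)`. -/
theorem status_odds_le {m : ℕ} {c ε : ℝ} (D₁ D₂ G : Measure X)
    [IsProbabilityMeasure (D₁ + D₂)] [IsProbabilityMeasure G]
    (hD₁ : D₁ ≤ ENNReal.ofReal (Real.exp c) • G)
    (K : Kernel (Draw m X) (Fin m → I)) [IsMarkovKernel K]
    (hK : ∀ w w' i, auditSet w = auditSet w' → (∀ j, j ≠ i → w.2.1 j = w'.2.1 j) →
      ∀ E, MeasurableSet E → K w E ≤ ENNReal.ofReal (Real.exp ε) * K w' E)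
    (i : Fin m) (w : Fin m → Bool × Bool) {E : Set (Fin m → I)} (hE : MeasurableSet E) :
    let ρ := ((Measure.pi fun _ : Fin m => recordLaw D₁ D₂ G) ⊗ₘ
      K.comap toDraw measurable_toDraw).map fun q => (status q.1, q.2)
    ρ ({Function.update w i (true, false)} ×ˢ E)
      ≤ ENNReal.ofReal (Real.exp (c + ε)) * ρ ({Function.update w i (false, false)} ×ˢ E) := by
  intro ρ
  set ψ : (Fin m → Bool × (X × Bool) × X) → ℝ≥0∞ := fun z => K (toDraw z) E
  have hψ : Measurable ψ := (K.measurable_coe hE).comp measurable_toDraw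
  set φ : (Fin m → Bool × Bool) → (Fin m → Bool × (X × Bool) × X) → ℝ≥0∞ :=
    fun x => (status ⁻¹' {x}).indicator ψ
  have hφ : ∀ x, Measurable (φ x) := fun x =>
    hψ.indicator (measurable_status (measurableSet_singleton x))
  have hρ : ∀ x, ρ ({x} ×ˢ E) = ∫⁻ z, φ x z ∂(Measure.pi fun _ => recordLaw D₁ D₂ G) := by
    intro x
    have hx := measurable_status (X := X) (measurableSet_singleton x)
    have : (fun q : (Fin m → Bool × (X × Bool) × X) × (Fin m → I) => (status q.1, q.2)) ⁻¹'
        ({x} ×ˢ E) = (status ⁻¹' {x}) ×ˢ E := rfl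
    rw [Measure.map_apply (by fun_prop) ((measurableSet_singleton x).prod hE), this,
      Measure.compProd_apply_prod hx hE, lintegral_indicator hx]
    rfl
  rw [hρ, hρ, ← lintegral_const_mul _ (hφ _)]
  refine lintegral_pi_le_of_update _ (hφ _) ((hφ _).const_mul _) i fun z => ?_
  have hupd : Measurable fun y => Function.update z i y := measurable_update z
  have hφupd : ∀ x, Measurable fun y => φ x (Function.update z i y) := fun x => (hφ x).comp hupd
  rw [lintegral_const_mul _ (hφupd _), lintegral_recordLaw _ _ _ (hφupd _),
    lintegral_recordLaw _ _ _ (hφupd _)]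
  -- If the frozen coordinates do not have the statuses prescribed by `w`, both sides vanish.
  by_cases hR : ∀ j, j ≠ i → status z j = w j
  swap
  · have h0 : ∀ a y, φ (Function.update w i a) (Function.update z i y) = 0 := fun a y =>
      Set.indicator_of_notMem (s := status ⁻¹' {Function.update w i a})
        (fun h => hR ((status_update_eq_iff z i y w a).1 h).2) ψ
    simp [h0]
  have hin : ∀ y, φ (Function.update w i (y.1, y.1 && y.2.1.2)) (Function.update z i y)
      = ψ (Function.update z i y) := fun y =>
    Set.indicator_of_mem (s := status ⁻¹' {Function.update w i (y.1, y.1 && y.2.1.2)})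
      ((status_update_eq_iff z i y w _).2 ⟨rfl, hR⟩) ψ
  have hout : ∀ a y, (y.1, y.1 && y.2.1.2) ≠ a →
      φ (Function.update w i a) (Function.update z i y) = 0 := fun a y h =>
    Set.indicator_of_notMem (s := status ⁻¹' {Function.update w i a})
      (fun h' => h ((status_update_eq_iff z i y w a).1 h').1) ψ
  have a1 : ∀ x g, φ (Function.update w i (true, false)) (Function.update z i (true, (x, false), g))
      = ψ (Function.update z i (true, (x, false), g)) := fun x g => hin (true, (x, false), g)
  have a2 : ∀ x g, φ (Function.update w i (true, false)) (Function.update z i (true, (x, true), g))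
      = 0 := fun x g => hout _ _ (by simp)
  have a3 : ∀ x b g, φ (Function.update w i (true, false)) (Function.update z i (false, (x, b), g))
      = 0 := fun x b g => hout _ _ (by simp)
  have b1 : ∀ x b g, φ (Function.update w i (false, false)) (Function.update z i (true, (x, b), g))
      = 0 := fun x b g => hout _ _ (by simp)
  have b2 : ∀ x b g, φ (Function.update w i (false, false)) (Function.update z i (false, (x, b), g))
      = ψ (Function.update z i (false, (x, b), g)) := fun x b g => hin (false, (x, b), g)
  -- The scores do not see the flag, so on the `0` side the integrals over `D₁` and `D₂` merge into
  -- one over `D₁ + D₂`.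
  have b3 : ∀ x b g, ψ (Function.update z i (false, (x, b), g))
      = ψ (Function.update z i (false, (x, false), g)) := by
    intro x b g
    have : toDraw (Function.update z i (false, (x, b), g))
        = toDraw (Function.update z i (false, (x, false), g)) := by
      simp only [toDraw]
      refine Prod.ext ?_ (Prod.ext ?_ ?_) <;>
      · ext1 j
        by_cases hj : j = i
        · subst hj; simp
        · simp [hj]
    simp only [ψ, this]
  simp only [a1, a2, a3, b1, b2, b3 _ true, lintegral_zero, add_zero, mul_zero,
    zero_add]
  rw [← lintegral_add_measure, mul_left_comm]
  refine mul_le_mul_right ?_ _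
  -- The swap: `x` moves from being the member to being the generated point, so the audit set keeps
  -- `x` at index `i` while the training record there becomes `x'`.
  have hdp : ∀ x g x', ψ (Function.update z i (true, (x, false), g))
      ≤ ENNReal.ofReal (Real.exp ε) * ψ (Function.update z i (false, (x', false), x)) := by
    intro x g x'
    refine hK _ _ i ?_ ?_ E hE
    · ext1 j
      by_cases hj : j = i
      · subst hj; simp [auditSet, toDraw]
      · simp [auditSet, toDraw, hj]
    · intro j hj; simp [toDraw, hj]
  have hmeas : ∀ x', Measurable fun x => ψ (Function.update z i (false, (x', false), x)) :=
    fun x' => hψ.comp (hupd.comp (by fun_prop))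
  have hbound : ∀ x', ∫⁻ x, ∫⁻ g, ψ (Function.update z i (true, (x, false), g)) ∂G ∂D₁
      ≤ ENNReal.ofReal (Real.exp (c + ε)) *
        ∫⁻ x, ψ (Function.update z i (false, (x', false), x)) ∂G := by
    intro x'
    calc ∫⁻ x, ∫⁻ g, ψ (Function.update z i (true, (x, false), g)) ∂G ∂D₁
        ≤ ∫⁻ x, ∫⁻ _, ENNReal.ofReal (Real.exp ε) *
            ψ (Function.update z i (false, (x', false), x)) ∂G ∂D₁ :=
          lintegral_mono fun x => lintegral_mono fun g => hdp x g x'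
      _ = ENNReal.ofReal (Real.exp ε) *
            ∫⁻ x, ψ (Function.update z i (false, (x', false), x)) ∂D₁ := by
          simp only [lintegral_const, measure_univ, mul_one]
          exact lintegral_const_mul _ (hmeas x')
      _ ≤ ENNReal.ofReal (Real.exp ε) * (ENNReal.ofReal (Real.exp c) *
            ∫⁻ x, ψ (Function.update z i (false, (x', false), x)) ∂G) := by
          gcongr
          refine (lintegral_mono' hD₁ le_rfl).trans (le_of_eq ?_)
          rw [lintegral_smul_measure, smul_eq_mul]
      _ = _ := by
          rw [← mul_assoc, ← ENNReal.ofReal_mul (Real.exp_pos ε).le, ← Real.exp_add, add_comm ε]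
  -- The bound holds for each `x'`; averaging it over the probability measure `D₁ + D₂` yields the
  -- right-hand side.
  calc ∫⁻ x, ∫⁻ g, ψ (Function.update z i (true, (x, false), g)) ∂G ∂D₁
      = ∫⁻ _, ∫⁻ x, ∫⁻ g, ψ (Function.update z i (true, (x, false), g)) ∂G ∂D₁ ∂(D₁ + D₂) := by
        simp only [lintegral_const, measure_univ, mul_one]
    _ ≤ ∫⁻ x', ENNReal.ofReal (Real.exp (c + ε)) *
          ∫⁻ x, ψ (Function.update z i (false, (x', false), x)) ∂G ∂(D₁ + D₂) :=
        lintegral_mono hbound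
    _ = _ := by
        refine lintegral_const_mul _ (Measurable.lintegral_prod_right' (ν := G)
          (f := fun p : X × X => ψ (Function.update z i (false, (p.1, false), p.2))) ?_)
        exact hψ.comp (hupd.comp (by fun_prop))

/-- Common form of both claims: the baseline and the attack enter only through the kernel `K` from
draws to scores, with the target model integrated out. -/
theorem exists_failure_kernel_of_draw {m : ℕ} {c ε : ℝ} (D₁ D₂ G : Measure X)
    [IsProbabilityMeasure (D₁ + D₂)] [IsProbabilityMeasure G]
    (hD₁ : D₁ ≤ ENNReal.ofReal (Real.exp c) • G)
    (K : Kernel (Draw m X) (Fin m → I)) [IsMarkovKernel K]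
    (hK : ∀ w w' i, auditSet w = auditSet w' → (∀ j, j ≠ i → w.2.1 j = w'.2.1 j) →
      ∀ E, MeasurableSet E → K w E ≤ ENNReal.ofReal (Real.exp ε) * K w' E)
    {Ω : Type*} [MeasurableSpace Ω] (μ : Measure Ω) [IsProbabilityMeasure μ] {W : Ω → Draw m X}
    {T : Ω → Fin m → I} (hW : Measurable W) (hT : Measurable T)
    (hμ : μ.map (fun ω => (W ω, T ω)) = drawLaw m (D₁ + D₂) G ⊗ₘ K) :
    ∃ F : Kernel (Fin m → I) (Fin (m + 1)), IsMarkovKernel F ∧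
      (∀ᵐ t ∂(μ.map T), ∀ v : ℝ, condDistrib (fun ω => score (T ω) (W ω).1) T μ t (Set.Ici v)
        ≤ tailBound (logistic (c + ε)) (F t) t v) ∧
      meanFailures (μ.map T) F = m * (2⁻¹ * D₂ Set.univ) := by
  set π := Measure.pi fun _ : Fin m => recordLaw D₁ D₂ G
  set Q := π ⊗ₘ K.comap toDraw measurable_toDraw
  have hst : Measurable fun q : (Fin m → Bool × (X × Bool) × X) × (Fin m → I) =>
      (status q.1, q.2) := by fun_prop
  have hQ : Q.map (fun q => (toDraw q.1, q.2)) = drawLaw m (D₁ + D₂) G ⊗ₘ K := by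
    ext s hs
    rw [Measure.map_apply (by fun_prop) hs, Measure.compProd_apply (hs.preimage (by fun_prop)),
      Measure.compProd_apply hs, ← map_toDraw,
      lintegral_map (Kernel.measurable_kernel_prodMk_left hs) measurable_toDraw]
    rfl
  have : IsProbabilityMeasure (Q.map fun q => (status q.1, q.2)) :=
    Measure.isProbabilityMeasure_map hst.aemeasurable
  obtain ⟨F, hF, hFt, hFm⟩ := exists_failure_kernel (c + ε) μ (S := fun ω => (W ω).1)
    (measurable_fst.comp hW) hT (Q.map fun q => (status q.1, q.2)) (by
      have h := congrArg (Measure.map fun q : Draw m X × (Fin m → I) => (q.1.1, q.2))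
        (hμ.trans hQ.symm)
      rw [Measure.map_map (by fun_prop) (by fun_prop),
        Measure.map_map (by fun_prop) (by fun_prop)] at h
      rw [Measure.map_map (by fun_prop) hst]
      exact h) fun i w E hE => status_odds_le D₁ D₂ G hD₁ K hK i w hE
  refine ⟨F, hF, hFt, ?_⟩
  have hc : Measurable fun w : Fin m → Bool × Bool => (flagCount w : ℝ≥0∞) :=
    measurable_of_finite _
  have hfst : Q.map Prod.fst = π := Measure.fst_compProd _ _
  have hmap : (Q.map fun q => (status q.1, q.2)).map Prod.fst = π.map status := by
    rw [← hfst, Measure.map_map measurable_fst hst,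
      Measure.map_map measurable_status measurable_fst]
    rfl
  have h1 := lintegral_map (μ := Q.map fun q => (status q.1, q.2)) hc measurable_fst
  have h2 := lintegral_map (μ := π) hc measurable_status
  rw [hFm, ← h1, hmap, h2, lintegral_flagCount_status]

end Extended

end MembershipAudit

/-! ### The baseline and the attack -/

theorem mainTheorem5 {X Θ : Type*} [MeasurableSpace X] [MeasurableSpace Θ] (m k : ℕ)
    (D G : Measure X) [IsProbabilityMeasure D] [IsProbabilityMeasure G]
    (c γ ε : ℝ) (hc : 0 ≤ c) (hγ : 0 ≤ γ) (hε : 0 ≤ ε)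
    (hclose : MembershipAudit.IsClose c γ G D)
    (M : Kernel (Fin m ⊕ Fin k → X) Θ) [IsMarkovKernel M] (hM : MembershipAudit.IsPureDP ε M)
    (r : Fin k → X)
    (B : Kernel (Fin m → X) (Fin m → I)) [IsMarkovKernel B]
    (A : Kernel ((Fin m → X) × Θ) (Fin m → I)) [IsMarkovKernel A] :
    ∃ Fb Fa : Kernel (Fin m → I) (Fin (m + 1)), IsMarkovKernel Fb ∧ IsMarkovKernel Fa ∧
      (∀ᵐ t ∂((MembershipAudit.baselineLaw D G B).map Prod.snd), ∀ v : ℝ,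
        condDistrib (fun w => MembershipAudit.score w.2 w.1.1) Prod.snd
            (MembershipAudit.baselineLaw D G B) t (Set.Ici v)
          ≤ MembershipAudit.tailBound (MembershipAudit.logistic c) (Fb t) t v) ∧
      (∀ᵐ t ∂((MembershipAudit.attackLaw D G M r A).map Prod.snd), ∀ v : ℝ,
        condDistrib (fun w => MembershipAudit.score w.2 w.1.1.1) Prod.snd
            (MembershipAudit.attackLaw D G M r A) t (Set.Ici v)
          ≤ MembershipAudit.tailBound (MembershipAudit.logistic (c + ε)) (Fa t) t v) ∧
      MembershipAudit.meanFailures ((MembershipAudit.baselineLaw D G B).map Prod.snd) Fb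
        = MembershipAudit.meanFailures ((MembershipAudit.attackLaw D G M r A).map Prod.snd) Fa ∧
      MembershipAudit.meanFailures ((MembershipAudit.baselineLaw D G B).map Prod.snd) Fb
        ≤ ENNReal.ofReal (2 * m * γ) := by
  open MembershipAudit in
  obtain ⟨D₁, D₂, rfl, hD₁, hD₂⟩ := hclose.exists_add_eq
  -- Baseline scores depend on the audit set alone, so the stability condition holds with factor
  -- `e^0`.
  obtain ⟨Fb, hFb, hFbt, hFbm⟩ := exists_failure_kernel_of_draw (m := m) (ε := 0) D₁ D₂ G hD₁
    (B.comap auditSet measurable_auditSet)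
    (fun w w' i h _ E _ => by simp [Kernel.comap_apply, h])
    (baselineLaw (D₁ + D₂) G B) measurable_fst measurable_snd Measure.map_id
  have hq : Measurable fun z : Draw m X × Θ => (auditSet z.1, z.2) :=
    (measurable_auditSet.comp measurable_fst).prodMk measurable_snd
  have hKapp : ∀ w {E : Set (Fin m → I)}, MeasurableSet E →
      (M.comap (trainingSet r) (measurable_trainingSet r) ⊗ₖ
        A.comap (fun z : Draw m X × Θ => (auditSet z.1, z.2)) hq).snd w E
      = ∫⁻ θ, A (auditSet w, θ) E ∂(M (trainingSet r w)) := by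
    intro w E hE
    rw [Kernel.snd_apply' _ _ hE, Kernel.compProd_apply (measurable_snd hE)]
    rfl
  obtain ⟨Fa, hFa, hFat, hFam⟩ := exists_failure_kernel_of_draw (m := m) (ε := ε) D₁ D₂ G hD₁
    (M.comap (trainingSet r) (measurable_trainingSet r) ⊗ₖ
      A.comap (fun z : Draw m X × Θ => (auditSet z.1, z.2)) hq).snd
    (fun w w' i h h' E hE => by
      -- With the audit set unchanged, `A` is mere post-processing of the model, so the privacy
      -- bound passes to the scores.
      have hle : M (trainingSet r w)
          ≤ ENNReal.ofReal (Real.exp ε) • M (trainingSet r w') := by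
        refine Measure.le_iff.2 fun O hO => hM _ _ ⟨Sum.inl i, ?_⟩ O hO
        rintro (j | j) hj
        · exact h' j fun hji => hj (congrArg Sum.inl hji)
        · rfl
      rw [hKapp w hE, hKapp w' hE, h]
      refine (lintegral_mono' hle le_rfl).trans (le_of_eq ?_)
      rw [lintegral_smul_measure, smul_eq_mul])
    (attackLaw (D₁ + D₂) G M r A) (measurable_fst.comp measurable_fst) measurable_snd (by
      ext s hs
      have hs' : MeasurableSet ((fun ω : (Draw m X × Θ) × (Fin m → I) => (ω.1.1, ω.2)) ⁻¹' s) :=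
        hs.preimage (by fun_prop)
      refine (Measure.map_apply (by fun_prop) hs).trans ?_
      change attackLaw (D₁ + D₂) G M r A ((fun ω => (ω.1.1, ω.2)) ⁻¹' s) = _
      rw [attackLaw, Measure.compProd_apply hs', modelLaw,
        Measure.lintegral_compProd (Kernel.measurable_kernel_prodMk_left hs'),
        Measure.compProd_apply hs]
      refine lintegral_congr fun w => ?_
      rw [hKapp w (measurable_prodMk_left hs)]
      rfl)
  rw [add_zero] at hFbt
  refine ⟨Fb, Fa, hFb, hFa, hFbt, hFat, hFbm.trans hFam.symm, hFbm.le.trans ?_⟩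
  -- The mean is in fact at most `m γ / 2`; the factor `1/2` is simply enlarged to `2`.
  calc (m : ℝ≥0∞) * (2⁻¹ * D₂ Set.univ) ≤ m * (2 * ENNReal.ofReal γ) := by
        gcongr
        exact (ENNReal.inv_le_one.2 (by norm_num)).trans (by norm_num)
    _ = ENNReal.ofReal (2 * m * γ) := by
        rw [ENNReal.ofReal_mul (by positivity), ENNReal.ofReal_mul (by norm_num),
          ENNReal.ofReal_natCast, ENNReal.ofReal_ofNat]
        ring
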